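/- A \emph{rectangle} means a nondegenerate closed rectangle in the $xy$-plane with sides parallel to the axes. Two rectangles \emph{see each other} if some vertical or horizontal line meets the interiors of both (the line may pass through other rectangles). A graph $G$ is a \emph{transparent rectangle visibility graph} (TRVG) if its vertices can be represented by pairwise disjoint rectangles so that any two distinct vertices are adjacent if and only if their rectangles see each other. \textbf{Theorem.} Let $k \ge 3$ and let $1 \le a_1 \le a_2 \le \dots \le a_k$ be integers. Then the complete $k$-partite graph $K_{a_1,a_2,\dots,a_k}$ is a TRVG if and only if $a_{k-1} \le 2$ or $(a_{k-2},a_{k-1},a_k) \in \{(1,3,3),(1,3,4),(2,3,3),(2,3,4)\}$. -/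

import Mathlib

/-- A nondegenerate rectangle in the plane with sides parallel to the axes. -/
structure AxisRect where
  left : ℝ
  right : ℝ
  bottom : ℝ
  top : ℝ
  left_lt_right : left < right
  bottom_lt_top : bottom < top

namespace AxisRect

/-- The closed rectangle as a set of points of the `xy`-plane. -/
def toSet (R : AxisRect) : Set (ℝ × ℝ) :=
  Set.Icc R.left R.right ×ˢ Set.Icc R.bottom R.top

/-- Some vertical line meets the interiors of both rectangles. -/
def SeesVertically (R S : AxisRect) : Prop :=
  ∃ c : ℝ, (∃ y : ℝ, (c, y) ∈ interior R.toSet) ∧ (∃ y : ℝ, (c, y) ∈ interior S.toSet)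

/-- Some horizontal line meets the interiors of both rectangles. -/
def SeesHorizontally (R S : AxisRect) : Prop :=
  ∃ c : ℝ, (∃ x : ℝ, (x, c) ∈ interior R.toSet) ∧ (∃ x : ℝ, (x, c) ∈ interior S.toSet)

/-- Two rectangles see each other along a vertical or a horizontal line. The line is not
blocked by other rectangles (rectangles are transparent). -/
def Sees (R S : AxisRect) : Prop :=
  R.SeesVertically S ∨ R.SeesHorizontally S

end AxisRect

/-- `G` is a transparent rectangle visibility graph: its vertices can be represented by pairwise
disjoint rectangles so that distinct vertices are adjacent exactly when their rectangles see
each other. -/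
def IsTRVG {V : Type*} (G : SimpleGraph V) : Prop :=
  ∃ R : V → AxisRect,
    (∀ u v : V, u ≠ v → Disjoint (R u).toSet (R v).toSet) ∧
    (∀ u v : V, u ≠ v → (G.Adj u v ↔ (R u).Sees (R v)))

/-! Two disjoint rectangles cannot overlap in both projections, so a representation splits the edges
of the graph into two interval graphs, one for each axis, in which every part is independent
(`IsSplit`).

Necessity: in one axis, the meeting pairs between parts of sizes `m` and `n` form a chain, so there
are at most `m + n - 1` of them (`meetCount_lt`). Both axes together give `mn ≤ 2(m + n - 1)`, that
is `(m - 2)(n - 2) ≤ 2`; if both sizes are at least 3, they are 3 and 3 or 3 and 4. It remains to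
exclude three parts of size 3 (`not_isSplit_three_three_three`). Of the 9 edges between two such
parts, 5 lie in one axis, so some axis gets 5 edges for two of the three pairs of parts. A finite
check then finds an induced 4-cycle in one axis, which no interval graph has.

Sufficiency: a part of size at most 2 consists of a long thin rectangle and its mirror image in the
diagonal, and any number of such parts fits around a square (`isTRVG_of_forall_le_two`). The square
holds either one part of any size or a copy of `K_{3,4}`. -/

open Finset

/-! ### Families of disjoint intervals -/

/-- The open intervals with endpoint pairs `I` and `J` have a common point. -/
def Meets (I J : ℝ × ℝ) : Prop := I.1 < J.2 ∧ J.1 < I.2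

theorem Meets.symm {I J : ℝ × ℝ} (h : Meets I J) : Meets J I := ⟨h.2, h.1⟩

theorem meets_comm {I J : ℝ × ℝ} : Meets I J ↔ Meets J I := ⟨Meets.symm, Meets.symm⟩

/-- The closed intervals with endpoint pairs `I` and `J` are disjoint. -/
def Apart (I J : ℝ × ℝ) : Prop := I.2 < J.1 ∨ J.2 < I.1

theorem Apart.symm {I J : ℝ × ℝ} (h : Apart I J) : Apart J I := Or.symm h

theorem Apart.not_meets {I J : ℝ × ℝ} (h : Apart I J) : ¬ Meets I J := by
  rintro ⟨h₁, h₂⟩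
  rcases h with h | h <;> linarith

/-- An intersection graph of intervals has no induced cycle of length four. -/
theorem no_induced_four_cycle {I I' J J' : ℝ × ℝ} (hI : ¬ Meets I I') (hJ : ¬ Meets J J')
    (h₁ : Meets I J) (h₂ : Meets I J') (h₃ : Meets I' J) (h₄ : Meets I' J') : False := by
  simp only [Meets, not_and_or, not_lt] at *
  -- `J` and `J'` both reach across the gap between `I` and `I'`, so they meet.
  rcases hI with hI | hI <;> rcases hJ with hJ | hJ <;> linarith [h₁.1, h₁.2, h₂.1, h₂.2, h₃.1,
    h₃.2, h₄.1, h₄.2]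

theorem le_of_not_meets {I J : ℝ × ℝ} (hJ : J.1 < J.2) (h : ¬ Meets I J)
    (hle : I.1 ≤ J.1) : I.2 ≤ J.1 := by
  simp only [Meets, not_and_or, not_lt] at h
  rcases h with h | h <;> linarith

/-- In two families of disjoint intervals, pairs of meeting intervals are never in opposite
order. -/
theorem not_meets_of_opposite {I I' J J' : ℝ × ℝ} (hI' : I'.1 < I'.2)
    (hJ : J.1 < J.2) (hII : ¬ Meets I I') (hJJ : ¬ Meets J J')
    (hIle : I.1 ≤ I'.1) (hJle : J'.1 ≤ J.1) (h : Meets I J) : ¬ Meets I' J' := by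
  intro h'
  have h₁ := le_of_not_meets hI' hII hIle
  have h₂ := le_of_not_meets hJ (fun h => hJJ h.symm) hJle
  linarith [h.2, h'.1]

/-- The number of meeting pairs of intervals of two families. -/
noncomputable def meetCount {α β : Type*} (f : α → ℝ × ℝ) (g : β → ℝ × ℝ) : ℕ :=
  Nat.card {p : α × β // Meets (f p.1) (g p.2)}

theorem meetCount_comm {α β : Type*} (f : α → ℝ × ℝ) (g : β → ℝ × ℝ) :
    meetCount f g = meetCount g f :=
  Nat.card_congr ((Equiv.prodComm α β).subtypeEquiv fun _ => meets_comm)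

theorem meetCount_comp {α β : Type*} (f : α → ℝ × ℝ) (g : β → ℝ × ℝ) (σ : α ≃ α) (τ : β ≃ β) :
    meetCount (f ∘ σ) (g ∘ τ) = meetCount f g :=
  Nat.card_congr ((σ.prodCongr τ).subtypeEquiv fun _ => Iff.rfl)

/-- The number of intervals of the family that begin before the interval `f s`. -/
noncomputable def leftRank {α : Type*} [Fintype α] (f : α → ℝ × ℝ) (s : α) : ℕ := by
  classical exact #{d | (f d).1 < (f s).1}

theorem leftRank_lt_card {α : Type*} [Fintype α] (f : α → ℝ × ℝ) (s : α) :
    leftRank f s < Fintype.card α := by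
  classical exact card_lt_univ_of_notMem (x := s) (by simp)

theorem leftRank_le {α : Type*} [Fintype α] {f : α → ℝ × ℝ} {s t : α}
    (h : (f s).1 ≤ (f t).1) : leftRank f s ≤ leftRank f t := by
  classical exact card_le_card fun d => by simpa using fun hd => lt_of_lt_of_le hd h

theorem leftRank_lt {α : Type*} [Fintype α] {f : α → ℝ × ℝ} {s t : α}
    (h : (f s).1 < (f t).1) : leftRank f s < leftRank f t := by
  classical
  refine card_lt_card ((ssubset_iff_of_subset fun d => ?_).2 ⟨s, ?_, ?_⟩)
  · simpa using fun hd => lt_trans hd h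
  · simpa using h
  · simp

theorem fst_lt_of_not_meets {I J : ℝ × ℝ} (hI : I.1 < I.2) (hJ : J.1 < J.2) (h : ¬ Meets I J)
    (hle : I.1 ≤ J.1) : I.1 < J.1 :=
  hI.trans_le (le_of_not_meets hJ h hle)

/-- Two families of `m` and `n` disjoint intervals have at most `m + n - 1` meeting pairs. -/
theorem meetCount_lt {α β : Type*} [Fintype α] [Fintype β] [Nonempty α] [Nonempty β]
    {f : α → ℝ × ℝ} {g : β → ℝ × ℝ}
    (hf : ∀ s, (f s).1 < (f s).2) (hg : ∀ t, (g t).1 < (g t).2)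
    (hff : ∀ s s', s ≠ s' → ¬ Meets (f s) (f s')) (hgg : ∀ t t', t ≠ t' → ¬ Meets (g t) (g t')) :
    meetCount f g < Fintype.card α + Fintype.card β := by
  -- Meeting pairs are ordered coordinatewise, so the sum of the two ranks is strictly increasing
  -- along them; it lies between 0 and `m + n - 2`.
  let r : {p : α × β // Meets (f p.1) (g p.2)} → Fin (Fintype.card α + Fintype.card β - 1) :=
    fun p => ⟨leftRank f p.1.1 + leftRank g p.1.2, by
      have := leftRank_lt_card f p.1.1
      have := leftRank_lt_card g p.1.2
      omega⟩
  have key : ∀ p q : {p : α × β // Meets (f p.1) (g p.2)}, (f p.1.1).1 ≤ (f q.1.1).1 →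
      r p = r q → p = q := by
    rintro ⟨⟨s, t⟩, hp⟩ ⟨⟨s', t'⟩, hq⟩ hle hr
    simp only [r, Fin.mk.injEq] at hr hle hp hq
    have hs : s = s' := by
      by_contra hs
      have h₁ : (g t).1 ≤ (g t').1 := by
        by_contra! h
        exact not_meets_of_opposite (hf s') (hg t) (hff s s' hs)
          (hgg t t' (by rintro rfl; exact lt_irrefl _ h)) hle h.le hp hq
      have h₂ := leftRank_le h₁
      have h₃ := leftRank_lt (fst_lt_of_not_meets (hf s) (hf s') (hff s s' hs) hle)
      omega
    subst hs
    have ht : t = t' := by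
      by_contra ht
      rcases le_total (g t).1 (g t').1 with h | h
      · have := leftRank_lt (fst_lt_of_not_meets (hg t) (hg t') (hgg t t' ht) h)
        omega
      · have := leftRank_lt (fst_lt_of_not_meets (hg t') (hg t) (hgg t' t (Ne.symm ht)) h)
        omega
    subst ht
    rfl
  have hinj : Function.Injective r := fun p q hr => by
    rcases le_total (f p.1.1).1 (f q.1.1).1 with h | h
    · exact key p q h hr
    · exact (key q p h hr.symm).symm
  have h := Nat.card_le_card_of_injective r hinj
  rw [Nat.card_fin] at h
  have : 0 < Fintype.card α := Fintype.card_pos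
  unfold meetCount
  omega

/-! ### Visibility in terms of projections -/

namespace AxisRect

/-- Endpoints of the projection to the `x`-axis. -/
def xSpan (R : AxisRect) : ℝ × ℝ := (R.left, R.right)

/-- Endpoints of the projection to the `y`-axis. -/
def ySpan (R : AxisRect) : ℝ × ℝ := (R.bottom, R.top)

theorem mem_interior_toSet (R : AxisRect) (p : ℝ × ℝ) :
    p ∈ interior R.toSet ↔
      (R.left < p.1 ∧ p.1 < R.right) ∧ (R.bottom < p.2 ∧ p.2 < R.top) := by
  rw [toSet, interior_prod_eq, interior_Icc, interior_Icc]
  rfl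

theorem seesVertically_iff (R S : AxisRect) :
    R.SeesVertically S ↔ Meets R.xSpan S.xSpan := by
  have hR := R.left_lt_right
  have hS := S.left_lt_right
  constructor
  · rintro ⟨c, ⟨y, hy⟩, ⟨z, hz⟩⟩
    rw [mem_interior_toSet] at hy hz
    exact ⟨hy.1.1.trans hz.1.2, hz.1.1.trans hy.1.2⟩
  · rintro ⟨h₁, h₂⟩
    obtain ⟨c, hc, hc'⟩ := exists_between
      (show max R.left S.left < min R.right S.right from
        max_lt (lt_min hR h₁) (lt_min h₂ hS))
    rw [max_lt_iff] at hc
    rw [lt_min_iff] at hc'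
    obtain ⟨y, hy⟩ := exists_between R.bottom_lt_top
    obtain ⟨z, hz⟩ := exists_between S.bottom_lt_top
    exact ⟨c, ⟨y, (mem_interior_toSet _ _).2 ⟨⟨hc.1, hc'.1⟩, hy⟩⟩,
      ⟨z, (mem_interior_toSet _ _).2 ⟨⟨hc.2, hc'.2⟩, hz⟩⟩⟩

theorem seesHorizontally_iff (R S : AxisRect) :
    R.SeesHorizontally S ↔ Meets R.ySpan S.ySpan := by
  have hR := R.bottom_lt_top
  have hS := S.bottom_lt_top
  constructor
  · rintro ⟨c, ⟨y, hy⟩, ⟨z, hz⟩⟩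
    rw [mem_interior_toSet] at hy hz
    exact ⟨hy.2.1.trans hz.2.2, hz.2.1.trans hy.2.2⟩
  · rintro ⟨h₁, h₂⟩
    obtain ⟨c, hc, hc'⟩ := exists_between
      (show max R.bottom S.bottom < min R.top S.top from
        max_lt (lt_min hR h₁) (lt_min h₂ hS))
    rw [max_lt_iff] at hc
    rw [lt_min_iff] at hc'
    obtain ⟨y, hy⟩ := exists_between R.left_lt_right
    obtain ⟨z, hz⟩ := exists_between S.left_lt_right
    exact ⟨c, ⟨y, (mem_interior_toSet _ _).2 ⟨hy, ⟨hc.1, hc'.1⟩⟩⟩,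
      ⟨z, (mem_interior_toSet _ _).2 ⟨hz, ⟨hc.2, hc'.2⟩⟩⟩⟩

theorem sees_iff (R S : AxisRect) :
    R.Sees S ↔ Meets R.xSpan S.xSpan ∨ Meets R.ySpan S.ySpan := by
  rw [Sees, seesVertically_iff, seesHorizontally_iff]

theorem not_meets_and_meets_of_disjoint {R S : AxisRect} (h : Disjoint R.toSet S.toSet) :
    ¬ (Meets R.xSpan S.xSpan ∧ Meets R.ySpan S.ySpan) := by
  rintro ⟨⟨h₁, h₂⟩, ⟨h₃, h₄⟩⟩
  refine Set.disjoint_left.1 h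
    (show (max R.left S.left, max R.bottom S.bottom) ∈ R.toSet from
    ⟨⟨le_max_left _ _, max_le R.left_lt_right.le h₂.le⟩,
      ⟨le_max_left _ _, max_le R.bottom_lt_top.le h₄.le⟩⟩)
    ⟨⟨le_max_right _ _, max_le h₁.le S.left_lt_right.le⟩,
      ⟨le_max_right _ _, max_le h₃.le S.bottom_lt_top.le⟩⟩

theorem disjoint_of_apart {R S : AxisRect}
    (h : Apart R.xSpan S.xSpan ∨ Apart R.ySpan S.ySpan) : Disjoint R.toSet S.toSet := by
  rw [Set.disjoint_left]
  rintro ⟨a, b⟩ ⟨⟨h₁, h₂⟩, ⟨h₃, h₄⟩⟩ ⟨⟨h₅, h₆⟩, ⟨h₇, h₈⟩⟩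
  simp only [Apart, xSpan, ySpan] at *
  rcases h with (h | h) | (h | h) <;> linarith

/-- Both pairs of projections are disjoint. -/
def Unseen (R S : AxisRect) : Prop :=
  Apart R.xSpan S.xSpan ∧ Apart R.ySpan S.ySpan

/-- One pair of projections overlaps and the other one is disjoint. -/
def SeesOnce (R S : AxisRect) : Prop :=
  (Meets R.xSpan S.xSpan ∧ Apart R.ySpan S.ySpan) ∨
    (Apart R.xSpan S.xSpan ∧ Meets R.ySpan S.ySpan)

theorem Unseen.symm {R S : AxisRect} (h : R.Unseen S) : S.Unseen R := ⟨h.1.symm, h.2.symm⟩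

theorem SeesOnce.symm {R S : AxisRect} (h : R.SeesOnce S) : S.SeesOnce R :=
  h.imp (fun h => ⟨h.1.symm, h.2.symm⟩) (fun h => ⟨h.1.symm, h.2.symm⟩)

end AxisRect

/-- Intervals that merely touch are neither `Meets` nor `Apart`. Constructions avoid them, so that
closed rectangles are disjoint as soon as one pair of projections is `Apart`. -/
theorem isTRVG_of_seesOnce {V : Type*} {G : SimpleGraph V} (R : V → AxisRect)
    (hadj : ∀ u v, G.Adj u v → (R u).SeesOnce (R v))
    (hnot : ∀ u v, u ≠ v → ¬ G.Adj u v → (R u).Unseen (R v)) : IsTRVG G := by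
  refine ⟨R, fun u v huv => AxisRect.disjoint_of_apart ?_, fun u v huv => ?_⟩
  · by_cases h : G.Adj u v
    · rcases hadj u v h with h | h
      exacts [Or.inr h.2, Or.inl h.1]
    · exact Or.inl (hnot u v huv h).1
  · rw [AxisRect.sees_iff]
    constructor
    · intro h
      exact (hadj u v h).imp And.left And.right
    · contrapose!
      intro h
      exact ⟨(hnot u v huv h).1.not_meets, (hnot u v huv h).2.not_meets⟩

/-! ### Splitting the edges between two axes -/

/-- Intervals `x i s` and `y i s` for the vertices of a complete multipartite graph with parts
`α i` such that each edge is an overlap in exactly one of the two families. -/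
structure IsSplit {ι : Type*} {α : ι → Type*} (x y : ∀ i, α i → ℝ × ℝ) : Prop where
  x_lt : ∀ i s, (x i s).1 < (x i s).2
  y_lt : ∀ i s, (y i s).1 < (y i s).2
  x_part : ∀ i s t, s ≠ t → ¬ Meets (x i s) (x i t)
  y_part : ∀ i s t, s ≠ t → ¬ Meets (y i s) (y i t)
  cross : ∀ i j s t, i ≠ j → (Meets (y i s) (y j t) ↔ ¬ Meets (x i s) (x j t))

theorem IsTRVG.exists_isSplit {ι : Type*} {α : ι → Type*}
    (h : IsTRVG (SimpleGraph.completeMultipartiteGraph α)) :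
    ∃ x y : ∀ i, α i → ℝ × ℝ, IsSplit x y := by
  obtain ⟨R, hdisj, hadj⟩ := h
  have part : ∀ i s t, s ≠ t → ¬ (R ⟨i, s⟩).Sees (R ⟨i, t⟩) := fun i s t hst => by
    rw [← hadj ⟨i, s⟩ ⟨i, t⟩ (by simpa using hst)]
    simp [SimpleGraph.completeMultipartiteGraph]
  simp only [AxisRect.sees_iff, not_or] at part
  refine ⟨fun i s => (R ⟨i, s⟩).xSpan, fun i s => (R ⟨i, s⟩).ySpan,
    fun i s => (R ⟨i, s⟩).left_lt_right, fun i s => (R ⟨i, s⟩).bottom_lt_top,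
    fun i s t hst => (part i s t hst).1, fun i s t hst => (part i s t hst).2,
    fun i j s t hij => ?_⟩
  have hne : (⟨i, s⟩ : Σ i, α i) ≠ ⟨j, t⟩ := fun h => hij (congrArg Sigma.fst h)
  have h₁ := AxisRect.not_meets_and_meets_of_disjoint (hdisj _ _ hne)
  have h₂ := (hadj _ _ hne).1 (by simpa [SimpleGraph.completeMultipartiteGraph] using hij)
  rw [AxisRect.sees_iff] at h₂
  tauto

namespace IsSplit

variable {ι ι' : Type*} {α : ι → Type*} {α' : ι' → Type*} {x y : ∀ i, α i → ℝ × ℝ}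

theorem swap (h : IsSplit x y) : IsSplit y x :=
  ⟨h.y_lt, h.x_lt, h.y_part, h.x_part, fun i j s t hij => by
    have := h.cross i j s t hij
    tauto⟩

theorem comap (h : IsSplit x y) (f : ι' → ι) (hf : Function.Injective f)
    (g : ∀ i, α' i → α (f i)) (hg : ∀ i, Function.Injective (g i)) :
    IsSplit (fun i s => x (f i) (g i s)) (fun i s => y (f i) (g i s)) :=
  ⟨fun _ _ => h.x_lt _ _, fun _ _ => h.y_lt _ _,
    fun _ _ _ hst => h.x_part _ _ _ ((hg _).ne hst),
    fun _ _ _ hst => h.y_part _ _ _ ((hg _).ne hst),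
    fun _ _ _ _ hij => h.cross _ _ _ _ (hf.ne hij)⟩

theorem meetCount_add [∀ i, Fintype (α i)] (h : IsSplit x y) {i j : ι} (hij : i ≠ j) :
    meetCount (x i) (x j) + meetCount (y i) (y j) =
      Fintype.card (α i) * Fintype.card (α j) := by
  classical
  have hy : meetCount (y i) (y j) =
      Nat.card {p : α i × α j // ¬ Meets (x i p.1) (x j p.2)} :=
    Nat.card_congr (Equiv.subtypeEquivRight fun p => h.cross i j p.1 p.2 hij)
  rw [hy, meetCount, Nat.card_eq_fintype_card, Nat.card_eq_fintype_card,
    ← Fintype.card_prod, Fintype.card_subtype_compl]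
  exact Nat.add_sub_cancel' (Fintype.card_subtype_le _)

theorem card_mul_card_add_two_le [∀ i, Fintype (α i)] (h : IsSplit x y) {i j : ι} (hij : i ≠ j)
    [Nonempty (α i)] [Nonempty (α j)] :
    Fintype.card (α i) * Fintype.card (α j) + 2 ≤
      2 * (Fintype.card (α i) + Fintype.card (α j)) := by
  have h₁ := meetCount_lt (h.x_lt i) (h.x_lt j) (h.x_part i) (h.x_part j)
  have h₂ := meetCount_lt (h.y_lt i) (h.y_lt j) (h.y_part i) (h.y_part j)
  have := h.meetCount_add hij
  omega

end IsSplit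

/-! ### The finite check on 3 × 3 matrices -/

/-- No two `true` entries of the matrix are in opposite order. -/
def IsStaircase (c : Fin 3 → Fin 3 → Bool) : Prop :=
  ∀ i i', i < i' → ∀ j j', j' < j → c i j → ¬ c i' j'

instance (c) : Decidable (IsStaircase c) := by unfold IsStaircase; infer_instance

/-- For independent sets `U`, `V`, `W` with bipartite adjacency matrices `a` of `U` and `V`, `b` of
`U` and `W`, `d` of `V` and `W`: there is an induced cycle of length four that has two opposite
vertices in `U`, a vertex in `V` and a vertex in `W`. -/
def HasMixedSquare (a b d : Fin 3 → Fin 3 → Bool) : Prop :=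
  ∃ i i', i < i' ∧ ∃ j j', a i j ∧ a i' j ∧ b i j' ∧ b i' j' ∧ ¬ d j j'

instance (a b d) : Decidable (HasMixedSquare a b d) := by unfold HasMixedSquare; infer_instance

/-- Some `2 × 2` submatrix has only `true` entries. -/
def HasSquare (c : Fin 3 → Fin 3 → Bool) : Prop :=
  ∃ i i', i < i' ∧ ∃ j j', j < j' ∧ c i j ∧ c i j' ∧ c i' j ∧ c i' j'

instance (c) : Decidable (HasSquare c) := by unfold HasSquare; infer_instance

/-- The tripartite graph with bipartite adjacency matrices `a`, `b`, `d` has an induced cycle of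
length four. -/
def HasInducedSquare (a b d : Fin 3 → Fin 3 → Bool) : Prop :=
  HasSquare a ∨ HasSquare b ∨ HasSquare d ∨ HasMixedSquare a b d ∨
    HasMixedSquare (fun j i => a i j) d b ∨
    HasMixedSquare (fun l i => b i l) (fun l j => d j l) a

instance (a b d) : Decidable (HasInducedSquare a b d) := by
  unfold HasInducedSquare; infer_instance

/-- The matrix whose entries are the binary digits of `n`. -/
def digitMatrix (n : ℕ) (i j : Fin 3) : Bool := n.testBit (3 * i + j)

/-- With five entries, a staircase is a monotone lattice path between opposite corners. Of the six
paths, the two that turn only once leave a 2 × 2 block of `false` entries; the other four are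
listed. -/
theorem exists_digitMatrix_of_isStaircase : ∀ a : Fin 3 → Fin 3 → Bool, IsStaircase a →
    ¬ HasSquare (fun i j => !a i j) →
    (∃ n ∈ ([51, 153, 273, 275, 281, 297, 305, 306, 307, 313, 387, 401, 403, 408, 409] :
      List ℕ), a = digitMatrix n) ∧
      (5 ≤ #{p : Fin 3 × Fin 3 | a p.1 p.2} → ∃ n ∈ ([307, 313, 403, 409] : List ℕ), a = digitMatrix n) := by
  decide +kernel

theorem hasInducedSquare_digitMatrix : ∀ a ∈ ([307, 313, 403, 409] : List ℕ), ∀ b ∈ ([307, 313, 403, 409] : List ℕ), ∀ d ∈ ([51, 153, 273, 275, 281, 297, 305, 306, 307, 313, 387, 401, 403, 408, 409] :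
      List ℕ),
    HasInducedSquare (digitMatrix a) (digitMatrix b) (digitMatrix d) ∨
      HasInducedSquare (fun i j => !digitMatrix a i j) (fun i j => !digitMatrix b i j)
        (fun i j => !digitMatrix d i j) := by
  decide +kernel

/-- Excluding squares in each complement separately leaves only 4 · 4 · 15 triples to inspect. -/
theorem hasInducedSquare_or_compl {a b d : Fin 3 → Fin 3 → Bool} (ha : IsStaircase a)
    (hb : IsStaircase b) (hd : IsStaircase d) (ha₅ : 5 ≤ #{p : Fin 3 × Fin 3 | a p.1 p.2})
    (hb₅ : 5 ≤ #{p : Fin 3 × Fin 3 | b p.1 p.2}) :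
    HasInducedSquare a b d ∨
      HasInducedSquare (fun i j => !a i j) (fun i j => !b i j) (fun i j => !d i j) := by
  by_cases ha' : HasSquare (fun i j => !a i j)
  · exact Or.inr (Or.inl ha')
  by_cases hb' : HasSquare (fun i j => !b i j)
  · exact Or.inr (Or.inr (Or.inl hb'))
  by_cases hd' : HasSquare (fun i j => !d i j)
  · exact Or.inr (Or.inr (Or.inr (Or.inl hd')))
  obtain ⟨m, hm, rfl⟩ := (exists_digitMatrix_of_isStaircase a ha ha').2 ha₅
  obtain ⟨n, hn, rfl⟩ := (exists_digitMatrix_of_isStaircase b hb hb').2 hb₅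
  obtain ⟨l, hl, rfl⟩ := (exists_digitMatrix_of_isStaircase d hd hd').1
  exact hasInducedSquare_digitMatrix m hm n hn l hl

/-! ### Excluding three parts of size three -/

section

variable {x y : Fin 3 → Fin 3 → ℝ × ℝ}

open Classical in
/-- The bipartite adjacency matrix between two families of intervals. -/
noncomputable def meetMatrix (f g : Fin 3 → ℝ × ℝ) (s t : Fin 3) : Bool :=
  decide (Meets (f s) (g t))

theorem meetMatrix_iff {f g : Fin 3 → ℝ × ℝ} {s t : Fin 3} :
    meetMatrix f g s t ↔ Meets (f s) (g t) := by simp [meetMatrix]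

theorem meetMatrix_swap (f g : Fin 3 → ℝ × ℝ) :
    (fun t s => meetMatrix f g s t) = meetMatrix g f := by
  ext t s
  rw [Bool.eq_iff_iff, meetMatrix_iff, meetMatrix_iff, meets_comm]

theorem card_meetMatrix (f g : Fin 3 → ℝ × ℝ) :
    #{p : Fin 3 × Fin 3 | meetMatrix f g p.1 p.2} = meetCount f g := by
  classical
  rw [meetCount, Nat.card_eq_fintype_card, Fintype.card_subtype]
  simp only [meetMatrix_iff]

theorem isStaircase_meetMatrix {f g : Fin 3 → ℝ × ℝ}
    (hf : ∀ s, (f s).1 < (f s).2) (hg : ∀ t, (g t).1 < (g t).2)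
    (hff : ∀ s s', s ≠ s' → ¬ Meets (f s) (f s')) (hgg : ∀ t t', t ≠ t' → ¬ Meets (g t) (g t'))
    (hfm : Monotone fun s => (f s).1) (hgm : Monotone fun t => (g t).1) :
    IsStaircase (meetMatrix f g) := by
  intro s s' hs t t' ht h
  rw [meetMatrix_iff] at h ⊢
  exact not_meets_of_opposite (hf _) (hg _) (hff _ _ hs.ne) (hgg _ _ ht.ne')
    (hfm hs.le) (hgm ht.le) h

theorem not_hasSquare_meetMatrix {f g : Fin 3 → ℝ × ℝ}
    (hff : ∀ s s', s ≠ s' → ¬ Meets (f s) (f s')) (hgg : ∀ t t', t ≠ t' → ¬ Meets (g t) (g t')) :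
    ¬ HasSquare (meetMatrix f g) := by
  rintro ⟨s, s', hs, t, t', ht, h⟩
  simp only [meetMatrix_iff] at h
  exact no_induced_four_cycle (hff _ _ hs.ne) (hgg _ _ ht.ne) h.1 h.2.1 h.2.2.1 h.2.2.2

theorem not_hasMixedSquare_meetMatrix {f g h : Fin 3 → ℝ × ℝ}
    (hff : ∀ s s', s ≠ s' → ¬ Meets (f s) (f s')) :
    ¬ HasMixedSquare (meetMatrix f g) (meetMatrix f h) (meetMatrix g h) := by
  rintro ⟨s, s', hs, t, t', H⟩
  simp only [meetMatrix_iff] at H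
  exact no_induced_four_cycle (hff _ _ hs.ne) H.2.2.2.2 H.1 H.2.2.1 H.2.1 H.2.2.2.1

theorem not_hasInducedSquare_meetMatrix {f g h : Fin 3 → ℝ × ℝ}
    (hff : ∀ s s', s ≠ s' → ¬ Meets (f s) (f s')) (hgg : ∀ t t', t ≠ t' → ¬ Meets (g t) (g t'))
    (hhh : ∀ t t', t ≠ t' → ¬ Meets (h t) (h t')) :
    ¬ HasInducedSquare (meetMatrix f g) (meetMatrix f h) (meetMatrix g h) := by
  simp only [HasInducedSquare, meetMatrix_swap, not_or]
  exact ⟨not_hasSquare_meetMatrix hff hgg, not_hasSquare_meetMatrix hff hhh,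
    not_hasSquare_meetMatrix hgg hhh, not_hasMixedSquare_meetMatrix hff,
    not_hasMixedSquare_meetMatrix hgg, not_hasMixedSquare_meetMatrix hhh⟩

namespace IsSplit

theorem meetMatrix_not (h : IsSplit x y) {i j : Fin 3} (hij : i ≠ j) :
    (fun s t => !meetMatrix (x i) (x j) s t) = meetMatrix (y i) (y j) := by
  ext s t
  rw [Bool.eq_iff_iff, meetMatrix_iff, h.cross i j s t hij, ← meetMatrix_iff]
  simp

/-- The complements of the `x` matrices are the `y` matrices, so the finite check yields an induced
4-cycle in one axis. Only the `x` intervals need to be sorted, as the staircase condition is not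
used for `y`. -/
theorem meetCount_lt_five_of_monotone (h : IsSplit x y)
    (hm : ∀ i, Monotone fun s => (x i s).1) (h₁ : 5 ≤ meetCount (x 0) (x 1)) :
    meetCount (x 0) (x 2) < 5 := by
  by_contra! h₂
  have st : ∀ i j, IsStaircase (meetMatrix (x i) (x j)) := fun i j =>
    isStaircase_meetMatrix (h.x_lt i) (h.x_lt j) (h.x_part i) (h.x_part j) (hm i) (hm j)
  have key := hasInducedSquare_or_compl (st 0 1) (st 0 2) (st 1 2)
    (by rwa [card_meetMatrix]) (by rwa [card_meetMatrix])
  rw [h.meetMatrix_not (by decide), h.meetMatrix_not (by decide),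
    h.meetMatrix_not (by decide)] at key
  exact key.elim (not_hasInducedSquare_meetMatrix (h.x_part _) (h.x_part _) (h.x_part _))
    (not_hasInducedSquare_meetMatrix (h.y_part _) (h.y_part _) (h.y_part _))

theorem meetCount_lt_five (h : IsSplit x y) {i j l : Fin 3} (hij : i ≠ j) (hil : i ≠ l)
    (hjl : j ≠ l) (h₁ : 5 ≤ meetCount (x i) (x j)) : meetCount (x i) (x l) < 5 := by
  -- Sorting each part by left endpoints preserves the split and the counts.
  let σ : ∀ i : Fin 3, Equiv.Perm (Fin 3) := fun i => Tuple.sort fun s => (x i s).1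
  have hinj : Function.Injective ![i, j, l] := by
    intro p q
    fin_cases p <;> fin_cases q <;> simp [hij, hil, hjl, hij.symm, hil.symm, hjl.symm]
  have h' := h.comap ![i, j, l] hinj (fun p => σ (![i, j, l] p)) fun p => (σ _).injective
  have hcount : ∀ p q, meetCount (x p ∘ σ p) (x q ∘ σ q) = meetCount (x p) (x q) := fun p q =>
    meetCount_comp _ _ _ _
  have := h'.meetCount_lt_five_of_monotone
    (fun p => Tuple.monotone_sort fun s => (x (![i, j, l] p) s).1)
    (le_of_le_of_eq h₁ (hcount i j).symm)
  exact lt_of_eq_of_lt (hcount i l).symm this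

end IsSplit

/-- The complete tripartite graph with parts of size three is not the edge-disjoint union of two
interval graphs. -/
theorem not_isSplit_three_three_three : ¬ IsSplit x y := by
  intro h
  -- Pigeonhole on 9 edges and two axes. Two of the three pairs of parts then choose the same axis,
  -- and any two pairs share a part.
  have dich : ∀ i j, i ≠ j → 5 ≤ meetCount (x i) (x j) ∨ 5 ≤ meetCount (y i) (y j) := by
    intro i j hij
    have := h.meetCount_add hij
    simp only [Fintype.card_fin] at this
    omega
  have hx := fun {i j l} => h.meetCount_lt_five (i := i) (j := j) (l := l)
  have hy := fun {i j l} => h.swap.meetCount_lt_five (i := i) (j := j) (l := l)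
  have h₀₁ := dich 0 1 (by decide)
  have h₀₂ := dich 0 2 (by decide)
  have h₁₂ := dich 1 2 (by decide)
  have a₁ := hx (i := 0) (j := 1) (l := 2) (by decide) (by decide) (by decide)
  have a₂ := hx (i := 1) (j := 0) (l := 2) (by decide) (by decide) (by decide)
  have a₃ := hx (i := 2) (j := 0) (l := 1) (by decide) (by decide) (by decide)
  have b₁ := hy (i := 0) (j := 1) (l := 2) (by decide) (by decide) (by decide)
  have b₂ := hy (i := 1) (j := 0) (l := 2) (by decide) (by decide) (by decide)
  have b₃ := hy (i := 2) (j := 0) (l := 1) (by decide) (by decide) (by decide)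
  rw [meetCount_comm (x 1) (x 0)] at a₂
  rw [meetCount_comm (x 2) (x 0), meetCount_comm (x 2) (x 1)] at a₃
  rw [meetCount_comm (y 1) (y 0)] at b₂
  rw [meetCount_comm (y 2) (y 0), meetCount_comm (y 2) (y 1)] at b₃
  omega

end

/-! ### Constructions -/

section

variable {k : ℕ} {a : Fin k → ℕ}

/-- The first vertex of a part `i` of size at most two: its projection to the `x`-axis
contains `[0, L]`, its projection to the `y`-axis is a short interval of negative numbers. -/
noncomputable def firstRect (k : ℕ) (L : ℝ) (hL : 0 < L) (i : Fin k) : AxisRect where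
  -- The long side starts after the short interval `[i - k, i - k + 1/4]` of the mirror image and
  -- before that of index `i + 1`. So it misses its own mirror image and, among the others, overlaps
  -- in `x` exactly those of larger index; those of smaller index are seen in `y`.
  left := i - k + 1 / 2
  right := L
  bottom := i - k
  top := i - k + 1 / 4
  left_lt_right := by
    have : ((i : ℕ) : ℝ) + 1 ≤ k := by exact_mod_cast i.2
    linarith
  bottom_lt_top := by linarith

/-- The reflection of a rectangle in the diagonal. -/
def AxisRect.transpose (R : AxisRect) : AxisRect :=
  ⟨R.bottom, R.top, R.left, R.right, R.bottom_lt_top, R.left_lt_right⟩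

theorem AxisRect.SeesOnce.transpose {R S : AxisRect} (h : R.SeesOnce S) :
    R.transpose.SeesOnce S.transpose :=
  Or.symm (h.imp And.symm And.symm)

/-- The rectangle lies in the square `[0, L]²`. -/
structure AxisRect.InSquare (L : ℝ) (R : AxisRect) : Prop where
  left_nonneg : 0 ≤ R.left
  right_le : R.right ≤ L
  bottom_nonneg : 0 ≤ R.bottom
  top_le : R.top ≤ L

theorem AxisRect.InSquare.transpose {L : ℝ} {R : AxisRect} (h : R.InSquare L) :
    R.transpose.InSquare L :=
  ⟨h.bottom_nonneg, h.top_le, h.left_nonneg, h.right_le⟩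

theorem firstRect_seesOnce {L : ℝ} (hL : 0 < L) {i j : Fin k} (hij : i ≠ j) :
    (firstRect k L hL i).SeesOnce (firstRect k L hL j) := by
  have hi : ((i : ℕ) : ℝ) + 1 ≤ k := by exact_mod_cast i.2
  have hj : ((j : ℕ) : ℝ) + 1 ≤ k := by exact_mod_cast j.2
  refine Or.inl ⟨⟨?_, ?_⟩, ?_⟩
  · simp only [AxisRect.xSpan, firstRect]; linarith
  · simp only [AxisRect.xSpan, firstRect]; linarith
  · simp only [Apart, AxisRect.ySpan, firstRect]
    rcases lt_or_gt_of_ne hij with h | h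
    · have : ((i : ℕ) : ℝ) + 1 ≤ (j : ℕ) := by exact_mod_cast h
      left; linarith
    · have : ((j : ℕ) : ℝ) + 1 ≤ (i : ℕ) := by exact_mod_cast h
      right; linarith

theorem firstRect_unseen {L : ℝ} (hL : 0 < L) (i : Fin k) :
    (firstRect k L hL i).Unseen (firstRect k L hL i).transpose := by
  refine ⟨Or.inr ?_, Or.inl ?_⟩ <;>
    simp only [AxisRect.xSpan, AxisRect.ySpan, AxisRect.transpose, firstRect] <;> linarith

theorem firstRect_seesOnce_transpose {L : ℝ} (hL : 0 < L) {i j : Fin k} (hij : i ≠ j) :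
    (firstRect k L hL i).SeesOnce (firstRect k L hL j).transpose := by
  have hi : ((i : ℕ) : ℝ) + 1 ≤ k := by exact_mod_cast i.2
  have hj : ((j : ℕ) : ℝ) + 1 ≤ k := by exact_mod_cast j.2
  simp only [AxisRect.SeesOnce, Meets, Apart, AxisRect.xSpan, AxisRect.ySpan,
    AxisRect.transpose, firstRect]
  rcases lt_or_gt_of_ne hij with h | h
  · have : ((i : ℕ) : ℝ) + 1 ≤ (j : ℕ) := by exact_mod_cast h
    exact Or.inl ⟨⟨by linarith, by linarith⟩, Or.inl (by linarith)⟩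
  · have : ((j : ℕ) : ℝ) + 1 ≤ (i : ℕ) := by exact_mod_cast h
    exact Or.inr ⟨Or.inr (by linarith), ⟨by linarith, by linarith⟩⟩

theorem firstRect_seesOnce_of_inSquare {L : ℝ} (hL : 0 < L) (i : Fin k) {R : AxisRect}
    (hR : R.InSquare L) : (firstRect k L hL i).SeesOnce R := by
  have hi : ((i : ℕ) : ℝ) + 1 ≤ k := by exact_mod_cast i.2
  have h₁ := R.left_lt_right
  have h₂ := hR.left_nonneg
  have h₃ := hR.right_le
  have h₄ := hR.bottom_nonneg
  refine Or.inl ⟨⟨?_, ?_⟩, Or.inl ?_⟩ <;>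
    simp only [AxisRect.xSpan, AxisRect.ySpan, firstRect] <;> linarith

/-- A representation of the parts from the index `m` on extends to one of the complete
multipartite graph if the parts before have at most two vertices. -/
theorem isTRVG_of_forall_le_two (m : ℕ) (ha : ∀ i : Fin k, (i : ℕ) < m → a i ≤ 2) (L : ℝ)
    (hL : 0 < L) (Z : ∀ i : Fin k, Fin (a i) → AxisRect)
    (hZ : ∀ (i : Fin k) s, m ≤ (i : ℕ) → (Z i s).InSquare L)
    (hpart : ∀ (i : Fin k) s t, m ≤ (i : ℕ) → s ≠ t → (Z i s).Unseen (Z i t))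
    (hcross : ∀ (i j : Fin k) s t, m ≤ (i : ℕ) → i < j → (Z i s).SeesOnce (Z j t)) :
    IsTRVG (SimpleGraph.completeMultipartiteGraph (fun i : Fin k => Fin (a i))) := by
  let R : (Σ i : Fin k, Fin (a i)) → AxisRect := fun u =>
    if (u.1 : ℕ) < m then
      if (u.2 : ℕ) = 0 then firstRect k L hL u.1 else (firstRect k L hL u.1).transpose
    else Z u.1 u.2
  have hadj : ∀ i j s t, i < j → (R ⟨i, s⟩).SeesOnce (R ⟨j, t⟩) := by
    intro i j s t hij
    simp only [R]
    split_ifs with h₁ h₂ h₃ h₄ h₅ h₆ h₇ h₈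
    · exact firstRect_seesOnce hL hij.ne
    · exact firstRect_seesOnce_transpose hL hij.ne
    · exact firstRect_seesOnce_of_inSquare hL i (hZ j t (not_lt.1 h₃))
    · exact (firstRect_seesOnce_transpose hL hij.ne').symm
    · exact (firstRect_seesOnce hL hij.ne).transpose
    -- The square is symmetric in the diagonal, so the mirrored claim suffices.
    · exact (firstRect_seesOnce_of_inSquare hL i (hZ j t (not_lt.1 h₅)).transpose).transpose
    · exact absurd ((show (i : ℕ) < j from hij).trans h₇) h₁
    · exact absurd ((show (i : ℕ) < j from hij).trans h₇) h₁
    · exact hcross i j s t (not_lt.1 h₁) hij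
  refine isTRVG_of_seesOnce R ?_ ?_
  · rintro ⟨i, s⟩ ⟨j, t⟩ h
    rcases lt_or_gt_of_ne (show i ≠ j by
      simpa [SimpleGraph.completeMultipartiteGraph] using h) with h | h
    · exact hadj i j s t h
    · exact (hadj j i t s h).symm
  · rintro ⟨i, s⟩ ⟨j, t⟩ hne h
    obtain rfl : i = j := by simpa [SimpleGraph.completeMultipartiteGraph] using h
    have hst : s ≠ t := by simpa using hne
    simp only [R]
    split_ifs with h₁ h₂ h₃ h₄
    · exact absurd (Fin.ext (h₂.trans h₃.symm)) hst
    · exact firstRect_unseen hL i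
    · exact (firstRect_unseen hL i).symm
    · have := ha i h₁
      exact absurd (Fin.ext (by omega)) hst
    · exact hpart i s t (not_lt.1 h₁) hst

theorem isTRVG_of_all_but_last_le_two (ha : ∀ i : Fin k, (i : ℕ) < k - 1 → a i ≤ 2) :
    IsTRVG (SimpleGraph.completeMultipartiteGraph (fun i : Fin k => Fin (a i))) := by
  refine isTRVG_of_forall_le_two (k - 1) ha ((∑ i, a i + 1 : ℕ) : ℝ) (by positivity)
    -- Small squares along the diagonal are mutually unseen; the sum of all part sizes plus 1 bounds
    -- them.
    (fun i s => ⟨s, s + 1 / 2, s, s + 1 / 2, by linarith, by linarith⟩) ?_ ?_ ?_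
  · intro i s _
    have h₁ : a i ≤ ∑ i, a i := single_le_sum (fun _ _ => Nat.zero_le _) (mem_univ i)
    have h₂ : ((s : ℕ) : ℝ) + 1 ≤ ((∑ i, a i + 1 : ℕ) : ℝ) := by
      have := s.2
      exact_mod_cast (by omega : (s : ℕ) + 1 ≤ ∑ i, a i + 1)
    constructor <;> dsimp only <;> first | positivity | linarith
  · intro i s t _ hst
    have : Apart ((s : ℕ), ((s : ℕ) : ℝ) + 1 / 2) ((t : ℕ), ((t : ℕ) : ℝ) + 1 / 2) := by
      rcases lt_or_gt_of_ne hst with h | h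
      · have : ((s : ℕ) : ℝ) + 1 ≤ (t : ℕ) := by exact_mod_cast h
        left; dsimp only; linarith
      · have : ((t : ℕ) : ℝ) + 1 ≤ (s : ℕ) := by exact_mod_cast h
        right; dsimp only; linarith
    exact ⟨this, this⟩
  · intro i j s t hi hij
    have := j.2
    have : (i : ℕ) < j := hij
    omega

/-- The vertices of the smaller part in a representation of `K_{3,4}`. -/
noncomputable def smallSideRect (s : ℕ) : AxisRect :=
  ⟨4 * s + 2, 4 * s + 5, 4 * s + 2, 4 * s + 5, by linarith, by linarith⟩

/-- The vertices of the larger part in a representation of `K_{3,4}`. -/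
noncomputable def largeSideRect (t : ℕ) : AxisRect :=
  -- In each axis the small-side interval `s` meets the slots `s` and `s + 1` out of four. The
  -- cyclic shift by 2 makes the pair met in `y` the complement of the pair met in `x`.
  ⟨4 * t, 4 * t + 3, 4 * ((t + 2) % 4 : ℕ), 4 * ((t + 2) % 4 : ℕ) + 3, by linarith, by linarith⟩

theorem smallSideRect_inSquare {s : ℕ} (hs : s < 3) : (smallSideRect s).InSquare 16 := by
  constructor <;> interval_cases s <;> norm_num [smallSideRect]

theorem largeSideRect_inSquare {t : ℕ} (ht : t < 4) : (largeSideRect t).InSquare 16 := by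
  constructor <;> interval_cases t <;> norm_num [largeSideRect]

theorem smallSideRect_unseen {s t : ℕ} (hs : s < 3) (ht : t < 3) (hst : s ≠ t) :
    (smallSideRect s).Unseen (smallSideRect t) := by
  interval_cases s <;> interval_cases t <;> first | contradiction |
    norm_num [smallSideRect, AxisRect.Unseen, Apart, AxisRect.xSpan, AxisRect.ySpan]

theorem largeSideRect_unseen {s t : ℕ} (hs : s < 4) (ht : t < 4) (hst : s ≠ t) :
    (largeSideRect s).Unseen (largeSideRect t) := by
  interval_cases s <;> interval_cases t <;> first | contradiction |
    norm_num [largeSideRect, AxisRect.Unseen, Apart, AxisRect.xSpan, AxisRect.ySpan]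

theorem smallSideRect_seesOnce {s t : ℕ} (hs : s < 3) (ht : t < 4) :
    (smallSideRect s).SeesOnce (largeSideRect t) := by
  interval_cases s <;> interval_cases t <;>
    norm_num [smallSideRect, largeSideRect, AxisRect.SeesOnce, Meets, Apart, AxisRect.xSpan,
      AxisRect.ySpan]

theorem isTRVG_of_last_two_le_three_four
    (ha : ∀ i : Fin k, (i : ℕ) < k - 2 → a i ≤ 2)
    (ha₃ : ∀ i : Fin k, (i : ℕ) = k - 2 → a i ≤ 3)
    (ha₄ : ∀ i : Fin k, (i : ℕ) = k - 1 → a i ≤ 4) :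
    IsTRVG (SimpleGraph.completeMultipartiteGraph (fun i : Fin k => Fin (a i))) := by
  refine isTRVG_of_forall_le_two (k - 2) ha 16 (by norm_num)
    (fun i s => if (i : ℕ) = k - 1 then largeSideRect s else smallSideRect s) ?_ ?_ ?_
  · intro i s hi
    have hs := s.2
    split_ifs with h
    · exact largeSideRect_inSquare (hs.trans_le (ha₄ i h))
    · exact smallSideRect_inSquare (hs.trans_le (ha₃ i (by omega)))
  · intro i s t hi hst
    have hs := s.2
    have ht := t.2
    split_ifs with h
    · exact largeSideRect_unseen (hs.trans_le (ha₄ i h)) (ht.trans_le (ha₄ i h))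
        (Fin.val_injective.ne hst)
    · have := ha₃ i (by omega)
      exact smallSideRect_unseen (by omega) (by omega) (Fin.val_injective.ne hst)
  · intro i j s t hi hij
    have hs := s.2
    have ht := t.2
    have hj := j.2
    have hij' : (i : ℕ) < j := hij
    rw [if_neg (by omega), if_pos (by omega)]
    have := ha₃ i (by omega)
    have := ha₄ j (by omega)
    exact smallSideRect_seesOnce (by omega) (by omega)

end

/-! ### The characterization -/

theorem mainTheorem2 (k : ℕ) (hk : 3 ≤ k) (a : Fin k → ℕ) (ha_pos : ∀ i, 1 ≤ a i)
    (ha_mono : Monotone a) :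
    IsTRVG (SimpleGraph.completeMultipartiteGraph (fun i : Fin k => Fin (a i))) ↔
      (a ⟨k - 2, by omega⟩ ≤ 2 ∨
        (a ⟨k - 3, by omega⟩, a ⟨k - 2, by omega⟩, a ⟨k - 1, by omega⟩) ∈
          ({(1, 3, 3), (1, 3, 4), (2, 3, 3), (2, 3, 4)} : Set (ℕ × ℕ × ℕ))) := by
  -- Indices start at 0, so the last three sizes sit at `k - 3`, `k - 2` and `k - 1`.
  have h₃ : a ⟨k - 3, by omega⟩ ≤ a ⟨k - 2, by omega⟩ :=
    ha_mono (Fin.mk_le_mk.2 (by omega))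
  have h₂ : a ⟨k - 2, by omega⟩ ≤ a ⟨k - 1, by omega⟩ :=
    ha_mono (Fin.mk_le_mk.2 (by omega))
  simp only [Set.mem_insert_iff, Set.mem_singleton_iff, Prod.mk.injEq]
  constructor
  · intro h
    obtain ⟨x, y, hxy⟩ := h.exists_isSplit
    have : ∀ i, Nonempty (Fin (a i)) := fun i => ⟨⟨0, ha_pos i⟩⟩
    by_contra! hcon
    have hcard := hxy.card_mul_card_add_two_le
      (i := ⟨k - 2, by omega⟩) (j := ⟨k - 1, by omega⟩) (by simp; omega)
    simp only [Fintype.card_fin] at hcard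
    have h₁ := ha_pos ⟨k - 3, by omega⟩
    have hthree : a ⟨k - 3, by omega⟩ ≤ 2 := by
      by_contra! hlt
      have hle : ∀ p : Fin 3, 3 ≤ a ⟨k - 3 + p, by omega⟩ := fun p =>
        hlt.trans_le (ha_mono (Fin.mk_le_mk.2 (by omega)))
      exact not_isSplit_three_three_three (hxy.comap
        (fun p : Fin 3 => (⟨k - 3 + p, by omega⟩ : Fin k))
        (fun p q hpq => Fin.ext (by simpa using hpq))
        (fun p => Fin.castLE (hle p)) (fun p => Fin.castLE_injective _))
    generalize a ⟨k - 3, by omega⟩ = b at *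
    generalize a ⟨k - 2, by omega⟩ = c at *
    generalize a ⟨k - 1, by omega⟩ = d at *
    -- From `(c - 2)(d - 2) ≤ 2` and `3 ≤ c ≤ d`; then also `d ≤ 4`.
    have hc : c = 3 := by nlinarith
    subst hc
    omega
  · rintro (h | h)
    · exact isTRVG_of_all_but_last_le_two fun i hi =>
        (ha_mono (Fin.le_def.2 (by simp; omega))).trans h
    · refine isTRVG_of_last_two_le_three_four (fun i hi => ?_) (fun i hi => ?_) (fun i hi => ?_)
      · have : a i ≤ a ⟨k - 3, by omega⟩ := ha_mono (Fin.le_def.2 (by simp; omega))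
        omega
      · rw [show i = ⟨k - 2, by omega⟩ from Fin.ext hi]
        omega
      · rw [show i = ⟨k - 1, by omega⟩ from Fin.ext hi]
        omega
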